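/- Let $R$ be a Dedekind domain with field of quotients $\mathbf Q$, and let $A$ be a nonzero torsion-free $R$-module of finite rank. Conventions. A submodule $K\le A$ is pure if $K\cap rA=rK$ for all $r\in R$. A module $M$ is $A$-generated if there is an epimorphism $A^{(I)}\to M$ for some set $I$. For torsion-free $R$-modules $M,N$ of finite rank, $M$ is quasi-isomorphic to $N$ if there are a monomorphism $f:M\to N$ and a nonzero $r\in R$ with $rN\subseteq f(M)$. The type $\mathbf{type}(B)$ of a torsion-free $R$-module $B$ of rank $1$ is its quasi-isomorphism class. Types are ordered by $\mathbf{type}(B)\le\mathbf{type}(B')$ if and only if there is a monomorphism $B\to B'$; any two types have an infimum, and for nonzero submodules $X,Y$ of $\mathbf Q$ it is $\inf\{\mathbf{type}(X),\mathbf{type}(Y)\}=\mathbf{type}(X\cap Y)$. For $0\ne a\in A$ let $\langle a\rangle_\star$ be the pure submodule of $A$ generated by $a$, i.e. the least pure submodule of $A$ containing $a$, which has rank $1$. The inner type of $A$ is $$\mathbf{IT}(A)=\inf\{\mathbf{type}(\langle x_1\rangle_\star),\dots,\mathbf{type}(\langle x_n\rangle_\star)\},$$ where $x_1,\dots,x_n$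 is any maximal linearly independent system of $A$ (the infimum does not depend on its choice). A submodule $B\le A$ is a quasi-direct summand of $A$ if there are a submodule $C\le A$ with $B\cap C=0$ and a nonzero $r\in R$ with $rA\subseteq B\oplus C$. The following are equivalent: (a) $A$ is a self-pure-generator, i.e. every pure submodule of $A$ is $A$-generated; (b) every pure submodule of $A$ of rank $1$ is $A$-generated; (c) $A$ has a quasi-direct summand $B$ of rank $1$ with $\mathbf{type}(B)=\mathbf{IT}(A)$; (d) $A$ has a direct summand $B$ of rank $1$ with $\mathbf{type}(B)=\mathbf{IT}(A)$. -/

import Mathlib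

open scoped nonZeroDivisors

namespace DedekindTF

universe u v w

section Basic

variable (R : Type u) [CommRing R] (A : Type v) [AddCommGroup A] [Module R A]

/-- A submodule `K` of `A` is pure if `K ∩ rA = rK` for all `r` in `R`. -/
def IsPure {R : Type u} [CommRing R] {A : Type v} [AddCommGroup A] [Module R A]
    (K : Submodule R A) : Prop :=
  ∀ (r : R) (a : A), r • a ∈ K → ∃ k ∈ K, r • k = r • a

/-- `M` is `A`-generated: there is an epimorphism from a direct sum of copies of `A` onto `M`. -/
def IsGeneratedBy (M : Type w) [AddCommGroup M] [Module R M] : Prop :=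
  ∃ (I : Type w) (f : (I →₀ A) →ₗ[R] M), Function.Surjective f

/-- `A` is a self-pure-generator: every pure submodule of `A` is `A`-generated. -/
def IsSelfPureGenerator : Prop :=
  ∀ K : Submodule R A, IsPure K → IsGeneratedBy R A K

/-- Quasi-isomorphism of torsion-free modules: there is a monomorphism `M → N` whose image
contains `rN` for some nonzero `r`. -/
def QuasiIso (M : Type v) [AddCommGroup M] [Module R M]
    (N : Type w) [AddCommGroup N] [Module R N] : Prop :=
  ∃ f : M →ₗ[R] N, Function.Injective f ∧ ∃ r : R, r ≠ 0 ∧ ∀ n : N, r • n ∈ LinearMap.range f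

variable {R A}

/-- `B` is a direct summand of `A`. -/
def IsDirectSummand (B : Submodule R A) : Prop :=
  ∃ C : Submodule R A, IsCompl B C

/-- `B` is a quasi-direct summand of `A`: for some submodule `C` the sum `B + C` is direct and
quasi-equal to `A` (that is, it contains `rA` for some nonzero `r`). -/
def IsQuasiDirectSummand (B : Submodule R A) : Prop :=
  ∃ C : Submodule R A, Disjoint B C ∧ ∃ r : R, r ≠ 0 ∧ ∀ a : A, r • a ∈ B ⊔ C

variable [IsDomain R]

/-- The pure submodule generated by `X` in a torsion-free module
(see `isLeast_pureClosure`). -/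
def pureClosure (X : Set A) : Submodule R A where
  carrier := {a | ∃ r : R, r ≠ 0 ∧ r • a ∈ Submodule.span R X}
  zero_mem' := ⟨1, one_ne_zero, by simp⟩
  add_mem' := by
    rintro a b ⟨r, hr, ha⟩ ⟨s, hs, hb⟩
    refine ⟨r * s, mul_ne_zero hr hs, ?_⟩
    rw [smul_add, mul_comm, mul_smul, mul_comm, mul_smul]
    exact add_mem (Submodule.smul_mem _ _ ha) (Submodule.smul_mem _ _ hb)
  smul_mem' := by
    rintro c a ⟨r, hr, ha⟩
    refine ⟨r, hr, ?_⟩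
    rw [smul_comm]
    exact Submodule.smul_mem _ _ ha

theorem isLeast_pureClosure [Module.IsTorsionFree R A] (X : Set A) :
    IsLeast {K : Submodule R A | IsPure K ∧ X ⊆ K} (pureClosure X) := by
  refine ⟨⟨?_, ?_⟩, ?_⟩
  · rintro r a ⟨s, hs, h⟩
    by_cases hr : r = 0
    · exact ⟨0, zero_mem _, by simp [hr]⟩
    · exact ⟨a, ⟨s * r, mul_ne_zero hs hr, by rwa [mul_smul]⟩, rfl⟩
  · intro x hx
    exact ⟨1, one_ne_zero, by simpa using Submodule.subset_span hx⟩
  · rintro K ⟨hK, hX⟩ a ⟨r, hr, h⟩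
    obtain ⟨k, hk, e⟩ := hK r a (Submodule.span_le.2 hX h)
    rwa [← smul_right_injective A hr e]

theorem mem_pureClosure_singleton {x a : A} :
    a ∈ pureClosure (R := R) {x} ↔ ∃ r : R, r ≠ 0 ∧ ∃ c : R, c • x = r • a := by
  change (∃ r : R, r ≠ 0 ∧ _) ↔ _
  simp only [Submodule.mem_span_singleton]

theorem rank_pureClosure_singleton [Module.IsTorsionFree R A] {x : A} (hx : x ≠ 0) :
    Module.rank R (pureClosure (R := R) {x}) = 1 := by
  have hx' : x ∈ pureClosure (R := R) {x} := (isLeast_pureClosure {x}).1.2 rfl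
  apply le_antisymm
  · rw [Module.rank_def]
    apply ciSup_le'
    rintro ⟨s, hs⟩
    rw [Cardinal.le_one_iff_subsingleton]
    refine ⟨fun a b => ?_⟩
    by_contra hab
    obtain ⟨r, hr, c, hc⟩ := mem_pureClosure_singleton.1 a.1.2
    obtain ⟨t, ht, d, hd⟩ := mem_pureClosure_singleton.1 b.1.2
    have hne : a.1 ≠ 0 := LinearIndependent.ne_zero (ι := s) (v := fun i => i.1) a hs
    have hi : Function.Injective ![a, b] := by
      intro i j hij
      fin_cases i <;> fin_cases j <;> simp_all [eq_comm]
    have hp := LinearIndependent.comp (ι := s) (v := fun i => i.1) hs ![a, b] hi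
    have e : ((fun i : s => i.1) ∘ ![a, b]) = ![a.1, b.1] := by
      funext i; fin_cases i <;> rfl
    rw [e] at hp
    have h0 := LinearIndependent.pair_iff.1 hp (d * r) (-(c * t)) (by
      apply Subtype.ext
      simp only [Submodule.coe_add, Submodule.coe_smul, neg_smul, Submodule.coe_neg, mul_smul,
        ← hc, ← hd, Submodule.coe_zero]
      rw [smul_comm]
      exact add_neg_cancel _)
    have hc0 : c = 0 := by simpa [ht] using h0.2
    rw [hc0, zero_smul] at hc
    rcases smul_eq_zero.1 hc.symm with h | h
    · exact hr h
    · exact hne (Subtype.ext h)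
  · rw [Cardinal.one_le_iff_ne_zero]
    have : Nontrivial (pureClosure (R := R) {x}) :=
      ⟨⟨x, hx'⟩, 0, fun h => hx (congrArg Subtype.val h)⟩
    exact rank_pos.ne'

end Basic

section Types

variable (R : Type u) [CommRing R] [IsDomain R]

/-- The nonzero submodules of the field of quotients of `R`. -/
abbrev RankOneSub : Type u := {X : Submodule R (FractionRing R) // X ≠ ⊥}

variable {R}

theorem exists_eq_mul {X : Submodule R (FractionRing R)} (f : X →ₗ[R] FractionRing R) :
    ∃ q : FractionRing R, ∀ x : X, f x = q * x := by
  by_cases hX : ∀ x : X, (x : FractionRing R) = 0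
  · exact ⟨0, fun x => by
      have : x = 0 := Subtype.ext (hX x)
      simp [this]⟩
  push Not at hX
  obtain ⟨y, hy⟩ := hX
  refine ⟨f y / y, fun x => ?_⟩
  obtain ⟨a, b, hb, e⟩ := IsFractionRing.div_surjective (A := R) ((x : FractionRing R) / y)
  have hb' : algebraMap R (FractionRing R) b ≠ 0 :=
    IsFractionRing.to_map_ne_zero_of_mem_nonZeroDivisors hb
  have h1 : b • x = a • y := by
    apply Subtype.ext
    simp only [Submodule.coe_smul, Algebra.smul_def]
    field_simp at e
    linear_combination -e
  have h2 := congrArg f h1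
  simp only [map_smul, Algebra.smul_def] at h2
  have h3 := congrArg Subtype.val h1
  simp only [Submodule.coe_smul, Algebra.smul_def] at h3
  apply mul_left_cancel₀ (mul_ne_zero hb' hy)
  rw [div_mul_eq_mul_div, mul_assoc, mul_assoc, mul_div_cancel₀ _ hy]
  linear_combination (y : FractionRing R) * h2 - f y * h3

theorem exists_mul_of_injective {X Y : RankOneSub R}
    (h : ∃ f : X.1 →ₗ[R] Y.1, Function.Injective f) :
    ∃ q : FractionRing R, q ≠ 0 ∧ ∀ x ∈ X.1, q * x ∈ Y.1 := by
  obtain ⟨f, hf⟩ := h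
  obtain ⟨q, hq⟩ := exists_eq_mul (Y.1.subtype ∘ₗ f)
  refine ⟨q, ?_, fun x hx => by
    have := hq ⟨x, hx⟩
    simp only [LinearMap.comp_apply, Submodule.subtype_apply] at this
    rw [← this]; exact (f _).2⟩
  rintro rfl
  obtain ⟨x, hx, h0⟩ := Submodule.exists_mem_ne_zero_of_ne_bot X.2
  apply h0
  have h1 : f ⟨x, hx⟩ = f 0 := by
    apply Subtype.ext
    simpa using hq ⟨x, hx⟩
  exact congrArg Subtype.val (hf h1)

theorem injective_of_mul {X Y : RankOneSub R} {q : FractionRing R} (hq : q ≠ 0)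
    (h : ∀ x ∈ X.1, q * x ∈ Y.1) : ∃ f : X.1 →ₗ[R] Y.1, Function.Injective f := by
  refine ⟨((LinearMap.mulLeft R q).restrict (p := X.1) (q := Y.1) h), ?_⟩
  intro a b hab
  apply Subtype.ext
  exact mul_left_cancel₀ hq (congrArg Subtype.val hab)

theorem QuasiIso.refl (M : Type v) [AddCommGroup M] [Module R M] : QuasiIso R M M :=
  ⟨LinearMap.id, fun _ _ h => h, 1, one_ne_zero, fun n => ⟨1 • n, by simp⟩⟩

theorem quasiIso_of_injective {X Y : RankOneSub R}
    (h : ∃ f : X.1 →ₗ[R] Y.1, Function.Injective f)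
    (h' : ∃ f : Y.1 →ₗ[R] X.1, Function.Injective f) : QuasiIso R X.1 Y.1 := by
  obtain ⟨f, hf⟩ := h
  obtain ⟨q, hq⟩ := exists_eq_mul (Y.1.subtype ∘ₗ f)
  simp only [LinearMap.comp_apply, Submodule.subtype_apply] at hq
  obtain ⟨p, hp, hpm⟩ := exists_mul_of_injective h'
  obtain ⟨q', hq', hqm⟩ := exists_mul_of_injective ⟨f, hf⟩
  have hq0 : q ≠ 0 := by
    rintro rfl
    obtain ⟨x, hx, h0⟩ := Submodule.exists_mem_ne_zero_of_ne_bot X.2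
    apply h0
    have h1 : f ⟨x, hx⟩ = f 0 := by
      apply Subtype.ext
      simpa using hq ⟨x, hx⟩
    exact congrArg Subtype.val (hf h1)
  obtain ⟨a, b, hb, e⟩ := IsFractionRing.div_surjective (A := R) (p * q)
  have hb' : algebraMap R (FractionRing R) b ≠ 0 :=
    IsFractionRing.to_map_ne_zero_of_mem_nonZeroDivisors hb
  refine ⟨f, hf, a, ?_, fun y => ⟨b • ⟨p * y, hpm y y.2⟩, ?_⟩⟩
  · rintro rfl
    simp only [map_zero, zero_div] at e
    exact mul_ne_zero hp hq0 e.symm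
  · apply Subtype.ext
    rw [hq]
    simp only [Submodule.coe_smul, Algebra.smul_def]
    field_simp at e
    linear_combination -(y : FractionRing R) * e

theorem QuasiIso.exists_injective_symm {M : Type v} [AddCommGroup M] [Module R M]
    {N : Type w} [AddCommGroup N] [Module R N] [Module.IsTorsionFree R N]
    (h : QuasiIso R M N) : ∃ f : N →ₗ[R] M, Function.Injective f := by
  obtain ⟨f, hf, r, hr, H⟩ := h
  refine ⟨(LinearEquiv.ofInjective f hf).symm.toLinearMap ∘ₗ
    ((LinearMap.lsmul R N r).codRestrict (LinearMap.range f) H), ?_⟩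
  intro a b hab
  have := (LinearEquiv.ofInjective f hf).symm.injective hab
  exact smul_right_injective N hr (congrArg Subtype.val this)

theorem quasiIso_iff {X Y : RankOneSub R} : QuasiIso R X.1 Y.1 ↔
    (∃ f : X.1 →ₗ[R] Y.1, Function.Injective f) ∧ ∃ f : Y.1 →ₗ[R] X.1, Function.Injective f :=
  ⟨fun h => ⟨h.imp fun _ => And.left, h.exists_injective_symm⟩,
    fun h => quasiIso_of_injective h.1 h.2⟩

variable (R) in
/-- Quasi-isomorphism of nonzero submodules of the field of quotients. -/
instance rankOneSetoid : Setoid (RankOneSub R) where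
  r X Y := QuasiIso R X.1 Y.1
  iseqv := by
    refine ⟨fun X => QuasiIso.refl _, fun h => quasiIso_iff.2 (quasiIso_iff.1 h).symm, ?_⟩
    intro X Y Z h h'
    obtain ⟨⟨f, hf⟩, g, hg⟩ := quasiIso_iff.1 h
    obtain ⟨⟨f', hf'⟩, g', hg'⟩ := quasiIso_iff.1 h'
    exact quasiIso_iff.2 ⟨⟨f' ∘ₗ f, hf'.comp hf⟩, ⟨g ∘ₗ g', hg.comp hg'⟩⟩

variable (R) in
/-- Types: quasi-isomorphism classes of torsion-free modules of rank one, each of which is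
represented by nonzero submodules of the field of quotients. -/
def RankOneType : Type u := Quotient (rankOneSetoid R)

/-- The quasi-isomorphism class of `X`. -/
def RankOneType.mk (X : RankOneSub R) : RankOneType R := Quotient.mk _ X

/-- The type of `X` is at most the type of `Y` if there is a monomorphism `X → Y`. -/
instance : LE (RankOneType R) where
  le := Quotient.lift₂ (fun X Y : RankOneSub R => ∃ f : X.1 →ₗ[R] Y.1, Function.Injective f) (by
    intro X Y X' Y' h h'
    obtain ⟨⟨f, hf⟩, g, hg⟩ := quasiIso_iff.1 h
    obtain ⟨⟨f', hf'⟩, g', hg'⟩ := quasiIso_iff.1 h'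
    refine propext ⟨fun ⟨k, hk⟩ => ?_, fun ⟨k, hk⟩ => ?_⟩
    · exact ⟨f' ∘ₗ k ∘ₗ g, hf'.comp (hk.comp hg)⟩
    · exact ⟨g' ∘ₗ k ∘ₗ f, hg'.comp (hk.comp hf)⟩)

instance : PartialOrder (RankOneType R) where
  le_refl := by
    rintro ⟨X⟩
    exact ⟨LinearMap.id, fun _ _ h => h⟩
  le_trans := by
    rintro ⟨X⟩ ⟨Y⟩ ⟨Z⟩ ⟨f, hf⟩ ⟨g, hg⟩
    exact ⟨g ∘ₗ f, hg.comp hf⟩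
  le_antisymm := by
    rintro ⟨X⟩ ⟨Y⟩ h h'
    exact Quotient.sound (quasiIso_of_injective h h')

theorem inf_ne_bot (X Y : RankOneSub R) : X.1 ⊓ Y.1 ≠ ⊥ := by
  obtain ⟨x, hx, hx0⟩ := Submodule.exists_mem_ne_zero_of_ne_bot X.2
  obtain ⟨y, hy, hy0⟩ := Submodule.exists_mem_ne_zero_of_ne_bot Y.2
  obtain ⟨a, b, hb, e⟩ := IsFractionRing.div_surjective (A := R) (x / y)
  have hb' : algebraMap R (FractionRing R) b ≠ 0 :=
    IsFractionRing.to_map_ne_zero_of_mem_nonZeroDivisors hb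
  have h1 : b • x = a • y := by
    simp only [Algebra.smul_def]
    field_simp at e
    linear_combination -e
  refine (Submodule.ne_bot_iff _).2 ⟨b • x, ⟨X.1.smul_mem b hx, ?_⟩, ?_⟩
  · change b • x ∈ Y.1
    rw [h1]; exact Y.1.smul_mem a hy
  · rw [Algebra.smul_def]; exact mul_ne_zero hb' hx0

theorem le_mk_inf {Z X Y : RankOneSub R}
    (h : ∃ f : Z.1 →ₗ[R] X.1, Function.Injective f)
    (h' : ∃ f : Z.1 →ₗ[R] Y.1, Function.Injective f) :
    ∃ f : Z.1 →ₗ[R] (X.1 ⊓ Y.1 : Submodule R (FractionRing R)), Function.Injective f := by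
  obtain ⟨p, hp, hpm⟩ := exists_mul_of_injective h
  obtain ⟨q, hq, hqm⟩ := exists_mul_of_injective h'
  obtain ⟨a, b, hb, e⟩ := IsFractionRing.div_surjective (A := R) (p / q)
  have hb' : algebraMap R (FractionRing R) b ≠ 0 :=
    IsFractionRing.to_map_ne_zero_of_mem_nonZeroDivisors hb
  have h1 : algebraMap R (FractionRing R) b * p = algebraMap R (FractionRing R) a * q := by
    field_simp at e
    linear_combination -e
  refine injective_of_mul (Y := ⟨_, inf_ne_bot X Y⟩) (mul_ne_zero hb' hp) fun z hz => ⟨?_, ?_⟩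
  · rw [mul_assoc, ← Algebra.smul_def]
    exact X.1.smul_mem b (hpm z hz)
  · rw [h1, mul_assoc, ← Algebra.smul_def]
    exact Y.1.smul_mem a (hqm z hz)

/-- The infimum of the types of `X` and `Y` is the type of `X ∩ Y`. -/
instance : SemilatticeInf (RankOneType R) where
  inf := Quotient.lift₂ (fun X Y : RankOneSub R =>
      RankOneType.mk ⟨X.1 ⊓ Y.1, inf_ne_bot X Y⟩) (by
    intro X Y X' Y' h h'
    obtain ⟨⟨f, hf⟩, g, hg⟩ := quasiIso_iff.1 h
    obtain ⟨⟨f', hf'⟩, g', hg'⟩ := quasiIso_iff.1 h'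
    have il : ∀ X Y : RankOneSub R, Function.Injective (Submodule.inclusion
        (inf_le_left : X.1 ⊓ Y.1 ≤ X.1)) := fun X Y => Submodule.inclusion_injective _
    have ir : ∀ X Y : RankOneSub R, Function.Injective (Submodule.inclusion
        (inf_le_right : X.1 ⊓ Y.1 ≤ Y.1)) := fun X Y => Submodule.inclusion_injective _
    refine Quotient.sound (quasiIso_of_injective ?_ ?_)
    · exact le_mk_inf (Z := ⟨_, inf_ne_bot X Y⟩) ⟨f ∘ₗ _, hf.comp (il X Y)⟩
        ⟨f' ∘ₗ _, hf'.comp (ir X Y)⟩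
    · exact le_mk_inf (Z := ⟨_, inf_ne_bot X' Y'⟩) ⟨g ∘ₗ _, hg.comp (il X' Y')⟩
        ⟨g' ∘ₗ _, hg'.comp (ir X' Y')⟩)
  inf_le_left := by
    rintro ⟨X⟩ ⟨Y⟩
    exact ⟨Submodule.inclusion inf_le_left, Submodule.inclusion_injective _⟩
  inf_le_right := by
    rintro ⟨X⟩ ⟨Y⟩
    exact ⟨Submodule.inclusion inf_le_right, Submodule.inclusion_injective _⟩
  le_inf := by
    rintro ⟨Z⟩ ⟨X⟩ ⟨Y⟩ h h'
    exact le_mk_inf h h'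

variable (R) (B : Type v) [AddCommGroup B] [Module R B] [Module.IsTorsionFree R B]

/-- A torsion-free module of rank one is isomorphic to a nonzero submodule of the field of
quotients. -/
theorem exists_rankOneSub (hB : Module.rank R B = 1) :
    ∃ X : RankOneSub R, Nonempty (B ≃ₗ[R] X.1) := by
  let L := LocalizedModule R⁰ B
  have h1 : Module.finrank R B = 1 := by simp [Module.finrank, hB]
  have h2 : Module.finrank (FractionRing R) L = 1 := by
    rw [IsLocalization.finrank_eq (FractionRing R) R⁰ le_rfl,
      IsLocalizedModule.finrank_eq R⁰ (LocalizedModule.mkLinearMap R⁰ B) le_rfl, h1]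
  have hfin : Module.Finite (FractionRing R) L := Module.finite_of_finrank_eq_succ h2
  let e : L ≃ₗ[FractionRing R] FractionRing R := LinearEquiv.ofFinrankEq _ _ (by simp [h2])
  let f : B →ₗ[R] FractionRing R :=
    (e.restrictScalars R).toLinearMap ∘ₗ LocalizedModule.mkLinearMap R⁰ B
  have hf : Function.Injective f := by
    refine (e.injective : Function.Injective e).comp ?_
    intro a b hab
    obtain ⟨c, hc⟩ := (IsLocalizedModule.eq_iff_exists R⁰
      (LocalizedModule.mkLinearMap R⁰ B)).1 hab
    exact smul_right_injective B (nonZeroDivisors.ne_zero c.2) hc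
  refine ⟨⟨LinearMap.range f, ?_⟩, ⟨LinearEquiv.ofInjective f hf⟩⟩
  intro h
  rw [LinearMap.range_eq_bot] at h
  have hs : Subsingleton B := ⟨fun a b => hf (by simp [h])⟩
  have := Module.finrank_zero_of_subsingleton (R := R) (M := B)
  omega

/-- The type of a torsion-free module `B` of rank one: the quasi-isomorphism class of `B`. -/
noncomputable def typeOf (hB : Module.rank R B = 1) : RankOneType R :=
  RankOneType.mk (exists_rankOneSub R B hB).choose

variable {R B} in
theorem mk_le_typeOf_iff (hB : Module.rank R B = 1) (X : RankOneSub R) :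
    RankOneType.mk X ≤ typeOf R B hB ↔
      ∃ f : X.1 →ₗ[R] B, Function.Injective f := by
  obtain ⟨e⟩ := (exists_rankOneSub R B hB).choose_spec
  constructor
  · rintro ⟨f, hf⟩
    exact ⟨e.symm.toLinearMap ∘ₗ f, e.symm.injective.comp hf⟩
  · rintro ⟨f, hf⟩
    exact ⟨e.toLinearMap ∘ₗ f, e.injective.comp hf⟩

variable {R B} in
/-- Two torsion-free modules of rank one have the same type if and only if they are
quasi-isomorphic. -/
theorem typeOf_eq_iff {C : Type w} [AddCommGroup C] [Module R C] [Module.IsTorsionFree R C]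
    (hB : Module.rank R B = 1) (hC : Module.rank R C = 1) :
    typeOf R B hB = typeOf R C hC ↔ QuasiIso R B C := by
  obtain ⟨e⟩ := (exists_rankOneSub R B hB).choose_spec
  obtain ⟨e'⟩ := (exists_rankOneSub R C hC).choose_spec
  have h0 : typeOf R B hB = typeOf R C hC ↔ QuasiIso R (exists_rankOneSub R B hB).choose.1
      (exists_rankOneSub R C hC).choose.1 :=
    ⟨fun h => Quotient.exact h, fun h => Quotient.sound h⟩
  rw [h0]
  constructor
  · rintro ⟨f, hf, r, hr, H⟩
    refine ⟨e'.symm.toLinearMap ∘ₗ f ∘ₗ e.toLinearMap,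
      e'.symm.injective.comp (hf.comp e.injective), r, hr, fun c => ?_⟩
    obtain ⟨x, hx⟩ := H (e' c)
    exact ⟨e.symm x, by simp [hx]⟩
  · rintro ⟨f, hf, r, hr, H⟩
    refine ⟨e'.toLinearMap ∘ₗ f ∘ₗ e.symm.toLinearMap,
      e'.injective.comp (hf.comp e.symm.injective), r, hr, fun c => ?_⟩
    obtain ⟨x, hx⟩ := H (e'.symm c)
    exact ⟨e x, by simp [hx]⟩

end Types

section InnerType

variable (R : Type u) [CommRing R] [IsDomain R] (A : Type v) [AddCommGroup A] [Module R A]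

/-- A finite maximal linearly independent system `x₀, …, xₙ` of a nonzero module `A`. -/
structure MaximalIndependentSystem where
  n : ℕ
  x : Fin (n + 1) → A
  linearIndependent : LinearIndependent R x
  maximal : linearIndependent.Maximal

variable {R A} in
theorem MaximalIndependentSystem.exists_smul_mem_span (S : MaximalIndependentSystem R A) (a : A) :
    ∃ r : R, r ≠ 0 ∧ r • a ∈ Submodule.span R (Set.range S.x) := by
  by_contra hcon
  push Not at hcon
  have hli : LinearIndependent R (Fin.cons a S.x : Fin (S.n + 1 + 1) → A) := by
    refine LinearIndependent.finCons' a S.x S.linearIndependent fun c y hy h => ?_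
    by_contra hc
    refine hcon c hc ?_
    rw [eq_neg_of_add_eq_zero_left h]
    exact neg_mem hy
  have h := S.maximal _ hli.linearIndepOn_id (by
    rintro _ ⟨i, rfl⟩
    exact ⟨i.succ, by simp⟩)
  have ha : a ∈ Set.range S.x := by
    rw [h]; exact ⟨0, by simp⟩
  exact hcon 1 one_ne_zero (by simpa using Submodule.subset_span ha)

variable [Module.IsTorsionFree R A]

variable {A} in
/-- The type of a nonzero element `a`: the type of the pure submodule generated by `a`. -/
noncomputable def typeOfElement (a : A) (ha : a ≠ 0) : RankOneType R :=
  typeOf R (pureClosure (R := R) {a}) (rank_pureClosure_singleton ha)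

variable {R A} in
/-- The infimum of the types of the members of a maximal independent system. -/
noncomputable def MaximalIndependentSystem.infType (S : MaximalIndependentSystem R A) :
    RankOneType R :=
  Finset.univ.inf' Finset.univ_nonempty fun i =>
    typeOfElement R (S.x i) (S.linearIndependent.ne_zero i)

theorem nonempty_maximalIndependentSystem [Nontrivial A]
    (hA : Module.rank R A < Cardinal.aleph0) : Nonempty (MaximalIndependentSystem R A) := by
  have hpos : 0 < Module.finrank R A := by
    rw [Module.finrank, Cardinal.toNat_pos]
    exact ⟨rank_pos.ne', hA⟩
  obtain ⟨n, hn⟩ := Nat.exists_eq_succ_of_ne_zero hpos.ne'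
  obtain ⟨x, hx⟩ := _root_.exists_linearIndependent_of_le_finrank (R := R) (M := A) hn.ge
  refine ⟨n, x, hx, fun s hs hsub => ?_⟩
  have hc : Cardinal.mk s ≤ Module.rank R A := hs.cardinal_le_rank
  have hr : Module.rank R A = ((n + 1 : ℕ) : Cardinal) := by
    rw [← Nat.succ_eq_add_one, ← hn, Module.finrank, Cardinal.cast_toNat_of_lt_aleph0 hA]
  have hsf : s.Finite := Cardinal.lt_aleph0_iff_set_finite.1 (hc.trans_lt hA)
  apply Set.eq_of_subset_of_ncard_le hsub _ hsf
  have h1 : (Set.range x).ncard = n + 1 := by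
    rw [← Set.image_univ, Set.ncard_image_of_injective _ hx.injective, Set.ncard_univ,
      Nat.card_eq_fintype_card, Fintype.card_fin]
  rw [h1]
  have h2 : (s.ncard : Cardinal) = Cardinal.mk s := by
    have := hsf.to_subtype
    rw [← Nat.card_coe_set_eq]
    exact Nat.cast_card
  rw [hr, ← h2] at hc
  exact_mod_cast hc

variable {R A} in
/-- The infimum over a maximal independent system is the greatest lower bound of the types of
all nonzero elements. -/
theorem MaximalIndependentSystem.isGLB_infType (S : MaximalIndependentSystem R A) :
    IsGLB {t : RankOneType R | ∃ (a : A) (ha : a ≠ 0), t = typeOfElement R a ha} S.infType := by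
  constructor
  · rintro _ ⟨a, ha, rfl⟩
    obtain ⟨Z, hZ⟩ : ∃ Z, S.infType = RankOneType.mk Z := (Quotient.exists_rep S.infType).imp
      fun _ h => h.symm
    have hle : ∀ i, ∃ f : Z.1 →ₗ[R] (pureClosure (R := R) {S.x i}), Function.Injective f := by
      intro i
      refine (mk_le_typeOf_iff (rank_pureClosure_singleton
        (S.linearIndependent.ne_zero i)) Z).1 ?_
      rw [← hZ]
      exact Finset.inf'_le _ (Finset.mem_univ i)
    choose f hf using hle
    rw [hZ]
    refine (mk_le_typeOf_iff _ Z).2 ?_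
    obtain ⟨z, hz, hz0⟩ := Submodule.exists_mem_ne_zero_of_ne_bot Z.2
    let z₀ : Z.1 := ⟨z, hz⟩
    have hz₀ : z₀ ≠ 0 := fun h => hz0 (congrArg Subtype.val h)
    choose s hs t ht using fun i => mem_pureClosure_singleton.1 (f i z₀).2
    have ht0 : ∀ i, t i ≠ 0 := by
      intro i h0
      have h1 := ht i
      rw [h0, zero_smul] at h1
      rcases smul_eq_zero.1 h1.symm with h | h
      · exact hs i h
      · exact hz₀ (hf i (by rw [map_zero]; exact Subtype.ext h))
    obtain ⟨r, hr, hra⟩ := S.exists_smul_mem_span a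
    obtain ⟨c, hc⟩ := (Submodule.mem_span_range_iff_exists_fun R).1 hra
    let T : R := ∏ i, t i
    have hT : T ≠ 0 := Finset.prod_ne_zero_iff.2 fun i _ => ht0 i
    let g : Z.1 →ₗ[R] A := ∑ i, (c i * (∏ j ∈ Finset.univ.erase i, t j) * s i) •
      ((pureClosure (R := R) {S.x i}).subtype ∘ₗ f i)
    have hg : g z₀ = (T * r) • a := by
      rw [mul_smul, ← hc, Finset.smul_sum]
      simp only [g, LinearMap.sum_apply, LinearMap.smul_apply, LinearMap.comp_apply,
        Submodule.subtype_apply]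
      refine Finset.sum_congr rfl fun i _ => ?_
      rw [mul_smul, ← ht i, smul_smul, smul_smul]
      congr 1
      rw [mul_assoc, Finset.prod_erase_mul _ _ (Finset.mem_univ i), mul_comm]
    have key : ∀ y : Z.1, ∃ b : R, b ≠ 0 ∧ ∃ d : R, b • y = d • z₀ := by
      intro y
      obtain ⟨d, b, hb, e⟩ := IsFractionRing.div_surjective (A := R) ((y : FractionRing R) / z)
      have hb' : algebraMap R (FractionRing R) b ≠ 0 :=
        IsFractionRing.to_map_ne_zero_of_mem_nonZeroDivisors hb
      refine ⟨b, nonZeroDivisors.ne_zero hb, d, Subtype.ext ?_⟩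
      simp only [Submodule.coe_smul, Algebra.smul_def, z₀]
      field_simp at e
      linear_combination -e
    have hmem : ∀ y, g y ∈ pureClosure (R := R) {a} := by
      intro y
      obtain ⟨b, hb, d, e⟩ := key y
      refine mem_pureClosure_singleton.2 ⟨b, hb, d * (T * r), ?_⟩
      rw [mul_smul, ← hg, ← map_smul, ← map_smul, e]
    refine ⟨g.codRestrict _ hmem, ?_⟩
    rw [← LinearMap.ker_eq_bot, LinearMap.ker_codRestrict, LinearMap.ker_eq_bot']
    intro y hy
    obtain ⟨b, hb, d, e⟩ := key y
    have h1 := congrArg g e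
    rw [map_smul, map_smul, hy, smul_zero, hg, smul_smul] at h1
    have hd : d = 0 := by simpa [hT, hr, ha] using h1.symm
    rw [hd, zero_smul] at e
    exact (smul_eq_zero.1 e).resolve_left hb
  · intro τ hτ
    exact Finset.le_inf' _ _ fun i _ => hτ ⟨_, _, rfl⟩

/-- The inner type of a nonzero torsion-free module of finite rank: the infimum of the types of
the members of a maximal independent system. -/
noncomputable def innerType [Nontrivial A] (hA : Module.rank R A < Cardinal.aleph0) :
    RankOneType R :=
  (Classical.choice (nonempty_maximalIndependentSystem R A hA)).infType

/-- The inner type does not depend on the maximal independent system. -/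
theorem innerType_eq [Nontrivial A] (hA : Module.rank R A < Cardinal.aleph0)
    (S : MaximalIndependentSystem R A) : innerType R A hA = S.infType :=
  (MaximalIndependentSystem.isGLB_infType _).unique S.isGLB_infType

end InnerType

end DedekindTF

/-! The inner type is the greatest lower bound of the types of all nonzero elements; write ⟨a⟩ for
the pure closure of a.

From (b) to (c): every ⟨x⟩ receives a nonzero map from `A`. A group is not the union of two proper
subgroups, so some a survives two such maps, and ⟨a⟩ then embeds in both targets. Types of elements
are thus directed downwards, and the inner type, an infimum of finitely many of them, is the type of
some x. If f : A → ⟨x⟩ does not kill y, then y has the same type as x. An embedding g of ⟨x⟩ in ⟨y⟩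
followed by f acts on ⟨x⟩ as a nonzero scalar of the field of quotients, so ⟨y⟩ and ker f split `A`
up to quasi-equality (`isQuasiDirectSummand_pureClosure`).

From (c) to (d): a quasi-projection onto B gives f from `A` onto some Y in the field of quotients,
of the same type as B. Let J be the ideal of scalars s for which multiplication by s on Y lifts
through f. Since Y embeds in every ⟨a⟩ with f a ≠ 0, `mem_mul_of_bounded` yields JY = Y. As J is
invertible, its inverse also preserves Y, and writing 1 as a sum of products from J⁻¹ and J
assembles a splitting of f (`exists_rightInverse_of_injective`).

From (d) to (a): B embeds in ⟨a⟩ for every nonzero a, and adjoining one element to a rank one module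
multiplies it by an invertible fractional ideal. Hence a is a sum of images of B
(`mem_span_range_of_le`), and B is an image of `A`. -/

namespace DedekindTF

universe u v w

/-! ### Submodules of the field of quotients and invertible ideals -/

section FractionField

variable {R : Type u} [CommRing R] [IsDedekindDomain R]

local notation "K" => FractionRing R

/-- Any two elements of the field of quotients of a Dedekind domain are locally comparable. -/
theorem exists_add_eq_one_smul_mem_span (x b : K) :
    ∃ i j : R, i + j = 1 ∧ i • x ∈ Submodule.span R {b} ∧ j • b ∈ Submodule.span R {x} := by
  by_cases hx : x = 0
  · exact ⟨1, 0, by simp, by simp [hx], by simp⟩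
  let F : FractionalIdeal R⁰ K :=
    FractionalIdeal.spanSingleton R⁰ x + FractionalIdeal.spanSingleton R⁰ b
  have hxF : x ∈ F := (FractionalIdeal.mem_add _ _ _).2
    ⟨x, FractionalIdeal.mem_spanSingleton_self _ _, 0, FractionalIdeal.zero_mem _, add_zero _⟩
  have hbF : b ∈ F := (FractionalIdeal.mem_add _ _ _).2
    ⟨0, FractionalIdeal.zero_mem _, b, FractionalIdeal.mem_spanSingleton_self _ _, zero_add _⟩
  have hF : F ≠ 0 := by
    intro h
    rw [h, FractionalIdeal.mem_zero_iff] at hxF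
    exact hx hxF
  have h1 : (1 : K) ∈ F * F⁻¹ := by
    rw [mul_inv_cancel₀ hF]
    exact FractionalIdeal.one_mem_one _
  have hint : ∀ y ∈ F, ∀ z ∈ F⁻¹, ∃ r : R, algebraMap R K r = y * z := by
    intro y hy z hz
    have := FractionalIdeal.mul_mem_mul hy hz
    rw [mul_inv_cancel₀ hF] at this
    exact (FractionalIdeal.mem_one_iff _).1 this
  rw [add_mul, FractionalIdeal.mem_add] at h1
  obtain ⟨_, hz, _, hw, e⟩ := h1
  obtain ⟨z, hz', rfl⟩ := FractionalIdeal.mem_singleton_mul.1 hz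
  obtain ⟨w, hw', rfl⟩ := FractionalIdeal.mem_singleton_mul.1 hw
  obtain ⟨j, hj⟩ := hint x hxF z hz'
  obtain ⟨i, hi⟩ := hint b hbF w hw'
  obtain ⟨k, hk⟩ := hint x hxF w hw'
  obtain ⟨l, hl⟩ := hint b hbF z hz'
  -- From 1 = xz + bw with z, w in F⁻¹, take i = bw and j = xz; then ix = (xw)b and jb = (bz)x,
  -- where xw and bz lie in `R`.
  refine ⟨i, j, ?_, Submodule.mem_span_singleton.2 ⟨k, ?_⟩,
    Submodule.mem_span_singleton.2 ⟨l, ?_⟩⟩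
  · apply IsFractionRing.injective R K
    rw [map_add, hi, hj, map_one, ← e, add_comm]
  · rw [Algebra.smul_def, Algebra.smul_def, hk, hi]; ring
  · rw [Algebra.smul_def, Algebra.smul_def, hl, hj]; ring

/-- The ideal of all `r` such that `r • x` belongs to `B`. -/
def denominatorIdeal (B : Submodule R K) (x : K) : Ideal R :=
  B.comap (LinearMap.toSpanSingleton R K x)

omit [IsDedekindDomain R] in
theorem mem_denominatorIdeal {B : Submodule R K} {x : K} {r : R} :
    r ∈ denominatorIdeal B x ↔ r • x ∈ B := Iff.rfl

theorem exists_smul_eq_smul (x y : K) (hy : y ≠ 0) : ∃ d a : R, d ≠ 0 ∧ d • x = a • y := by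
  obtain ⟨a, d, hd, e⟩ := IsFractionRing.div_surjective (A := R) (x / y)
  have hd' : algebraMap R K d ≠ 0 := IsFractionRing.to_map_ne_zero_of_mem_nonZeroDivisors hd
  refine ⟨d, a, nonZeroDivisors.ne_zero hd, ?_⟩
  simp only [Algebra.smul_def]
  field_simp at e
  linear_combination -e

theorem denominatorIdeal_ne_bot {B : Submodule R K} (hB : B ≠ ⊥) (x : K) :
    denominatorIdeal B x ≠ ⊥ := by
  obtain ⟨y, hy, hy0⟩ := Submodule.exists_mem_ne_zero_of_ne_bot hB
  obtain ⟨d, a, hd, e⟩ := exists_smul_eq_smul x y hy0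
  refine (Submodule.ne_bot_iff _).2 ⟨d, ?_, hd⟩
  rw [mem_denominatorIdeal, e]
  exact B.smul_mem a hy

/-- `B` need not be finitely generated, so x is compared with one b in `B` at a time. Splitting b =
ib + jb, the coefficient i sends x into Rb and so lies in the denominator ideal, while jb = cx with
c in that ideal. -/
theorem coeSubmodule_denominatorIdeal_mul (B : Submodule R K) (x : K) :
    IsLocalization.coeSubmodule K (denominatorIdeal B x) * (B ⊔ Submodule.span R {x}) = B := by
  apply le_antisymm
  · rw [Submodule.mul_le]
    rintro _ ⟨r, hr, rfl⟩ y hy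
    obtain ⟨b, hb, c, hc, rfl⟩ := Submodule.mem_sup.1 hy
    obtain ⟨s, rfl⟩ := Submodule.mem_span_singleton.1 hc
    simp only [Algebra.linearMap_apply, ← Algebra.smul_def, smul_add]
    refine add_mem (B.smul_mem r hb) ?_
    rw [smul_comm]
    exact B.smul_mem s (mem_denominatorIdeal.1 hr)
  · intro b hb
    obtain ⟨i, j, hij, hi, hj⟩ := exists_add_eq_one_smul_mem_span x b
    have h1 : b = i • b + j • b := by rw [← add_smul, hij, one_smul]
    have hB : Submodule.span R {b} ≤ B := (Submodule.span_singleton_le_iff_mem _ _).2 hb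
    rw [h1]
    refine add_mem ?_ ?_
    · rw [Algebra.smul_def]
      exact Submodule.mul_mem_mul ⟨i, hB hi, rfl⟩ (Submodule.mem_sup_left hb)
    · obtain ⟨c, hc⟩ := Submodule.mem_span_singleton.1 hj
      rw [← hc, Algebra.smul_def]
      refine Submodule.mul_mem_mul ⟨c, ?_, rfl⟩
        (Submodule.mem_sup_right (Submodule.mem_span_singleton_self x))
      rw [SetLike.mem_coe, mem_denominatorIdeal, hc]
      exact B.smul_mem j hb

theorem coe_inv_mul_coeSubmodule {I : Ideal R} (hI : I ≠ ⊥) :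
    (((I : FractionalIdeal R⁰ K)⁻¹ : FractionalIdeal R⁰ K) : Submodule R K) *
      IsLocalization.coeSubmodule K I = 1 := by
  have h : IsLocalization.coeSubmodule K I =
      ((I : FractionalIdeal R⁰ K) : Submodule R K) := (FractionalIdeal.coe_coeIdeal I).symm
  rw [h, ← FractionalIdeal.coe_mul, inv_mul_cancel₀ (FractionalIdeal.coeIdeal_ne_zero.2 hI),
    FractionalIdeal.coe_one]

/-- It makes x a sum of products pb, where multiplication by each p maps all of `B` into B + Rx. -/
theorem inv_denominatorIdeal_mul {B : Submodule R K} (hB : B ≠ ⊥) (x : K) :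
    (((denominatorIdeal B x : FractionalIdeal R⁰ K)⁻¹ : FractionalIdeal R⁰ K) : Submodule R K) * B
      = B ⊔ Submodule.span R {x} := by
  conv_lhs => arg 2; rw [← coeSubmodule_denominatorIdeal_mul B x]
  rw [← mul_assoc, coe_inv_mul_coeSubmodule (denominatorIdeal_ne_bot hB x), one_mul]

/-- If `Y / Z` is bounded, then `Z` is the product of `Y` and the annihilator of `Y / Z`. -/
theorem mem_mul_of_bounded {Y Z : Submodule R K} (hZ : Z ≤ Y) {r : R} (hr : r ≠ 0)
    (h : ∀ y ∈ Y, r • y ∈ Z) {J : Ideal R} (hJ : ∀ s : R, (∀ y ∈ Y, s • y ∈ Z) → s ∈ J)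
    {z : K} (hz : z ∈ Z) : z ∈ IsLocalization.coeSubmodule K J * Y := by
  by_cases hY : Y = ⊥
  · have : z = 0 := by simpa [hY] using hZ hz
    rw [this]; exact zero_mem _
  -- With B = rY and I = {s | sz ∈ B}, z lies in I⁻¹B = B + Rz ⊆ Z, and r lies in I because z lies
  -- in Y.
  let B : Submodule R K := Y.map (LinearMap.lsmul R K r)
  have hB : B ≠ ⊥ := by
    obtain ⟨y, hy, hy0⟩ := Submodule.exists_mem_ne_zero_of_ne_bot hY
    exact (Submodule.ne_bot_iff _).2 ⟨r • y, ⟨y, hy, rfl⟩, smul_ne_zero hr hy0⟩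
  have hI := denominatorIdeal_ne_bot hB z
  have hBZ : B ⊔ Submodule.span R {z} ≤ Z := by
    refine sup_le ?_ ((Submodule.span_singleton_le_iff_mem _ _).2 hz)
    rintro _ ⟨y, hy, rfl⟩
    exact h y hy
  have hrI : r ∈ denominatorIdeal B z := ⟨z, hZ hz, rfl⟩
  have hzm : z ∈ B ⊔ Submodule.span R {z} :=
    Submodule.mem_sup_right (Submodule.mem_span_singleton_self z)
  rw [← inv_denominatorIdeal_mul hB] at hzm hBZ
  -- Only I⁻¹B ⊆ Z and r ∈ I are needed from here on; forgetting that I came from z lets z vary in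
  -- the induction.
  generalize denominatorIdeal B z = I at *
  clear hz
  induction hzm using Submodule.mul_induction_on' with
  | mem_mul_mem p hp b hb =>
    obtain ⟨y, hy, rfl⟩ := hb
    -- The scalar s = pr is in I⁻¹I = R, and sY = pB ⊆ I⁻¹B ⊆ Z puts it in J.
    have h1 : p * algebraMap R K r ∈ (1 : Submodule R K) := by
      rw [← coe_inv_mul_coeSubmodule hI]
      exact Submodule.mul_mem_mul hp ⟨r, hrI, rfl⟩
    obtain ⟨s, hs⟩ := Submodule.mem_one.1 h1
    rw [LinearMap.lsmul_apply, Algebra.smul_def, ← mul_assoc, ← hs]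
    refine Submodule.mul_mem_mul ⟨s, hJ s fun y' hy' => ?_, rfl⟩ hy
    rw [Algebra.smul_def, hs, mul_assoc, ← Algebra.smul_def]
    exact hBZ (Submodule.mul_mem_mul hp ⟨y', hy', rfl⟩)
  | add a _ b _ ha hb => exact add_mem ha hb

end FractionField

/-! ### Comparing types, and quasi-direct summands of rank one -/

section TypeComparison

variable {R : Type u} [CommRing R] [IsDomain R]

theorem typeOf_eq_mk {B : Type v} [AddCommGroup B] [Module R B] [Module.IsTorsionFree R B]
    (hB : Module.rank R B = 1) (X : RankOneSub R) (e : B ≃ₗ[R] X.1) :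
    typeOf R B hB = RankOneType.mk X := by
  obtain ⟨e'⟩ := (exists_rankOneSub R B hB).choose_spec
  exact Quotient.sound (quasiIso_of_injective
    ⟨(e'.symm.trans e).toLinearMap, (e'.symm.trans e).injective⟩
    ⟨(e.symm.trans e').toLinearMap, (e.symm.trans e').injective⟩)

theorem typeOf_le_typeOf_iff {B : Type v} [AddCommGroup B] [Module R B]
    [Module.IsTorsionFree R B] {C : Type w} [AddCommGroup C] [Module R C]
    [Module.IsTorsionFree R C] (hB : Module.rank R B = 1) (hC : Module.rank R C = 1) :
    typeOf R B hB ≤ typeOf R C hC ↔ ∃ f : B →ₗ[R] C, Function.Injective f := by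
  obtain ⟨X, ⟨e⟩⟩ := exists_rankOneSub R B hB
  rw [typeOf_eq_mk hB X e, mk_le_typeOf_iff]
  constructor
  · rintro ⟨f, hf⟩
    exact ⟨f ∘ₗ e.toLinearMap, hf.comp e.injective⟩
  · rintro ⟨f, hf⟩
    exact ⟨f ∘ₗ e.symm.toLinearMap, hf.comp e.symm.injective⟩

theorem typeOf_eq_mk_iff {B : Type v} [AddCommGroup B] [Module R B]
    [Module.IsTorsionFree R B] (hB : Module.rank R B = 1) (X : RankOneSub R) :
    typeOf R B hB = RankOneType.mk X ↔ (∃ f : X.1 →ₗ[R] B, Function.Injective f) ∧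
      ∃ f : B →ₗ[R] X.1, Function.Injective f := by
  obtain ⟨Y, ⟨e⟩⟩ := exists_rankOneSub R B hB
  rw [typeOf_eq_mk hB Y e]
  constructor
  · intro h
    obtain ⟨⟨f, hf⟩, g, hg⟩ := quasiIso_iff.1 (Quotient.exact h)
    exact ⟨⟨e.symm.toLinearMap ∘ₗ g, e.symm.injective.comp hg⟩,
      f ∘ₗ e.toLinearMap, hf.comp e.injective⟩
  · rintro ⟨⟨f, hf⟩, g, hg⟩
    exact Quotient.sound (quasiIso_of_injective
      ⟨g ∘ₗ e.symm.toLinearMap, hg.comp e.symm.injective⟩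
      ⟨e.toLinearMap ∘ₗ f, e.injective.comp hf⟩)

variable {A : Type v} [AddCommGroup A] [Module R A]

theorem mem_pureClosure_self (a : A) : a ∈ pureClosure (R := R) {a} :=
  ⟨1, one_ne_zero, by simp⟩

/-- Every b in the pure closure satisfies sb = ca with s ≠ 0; if f b = 0, then c · f a = 0 forces c
= 0 and so b = 0. -/
theorem injective_comp_subtype_pureClosure [Module.IsTorsionFree R A] {M : Type w} [AddCommGroup M]
    [Module R M] [Module.IsTorsionFree R M] (f : A →ₗ[R] M) {a : A} (ha : f a ≠ 0) :
    Function.Injective (f ∘ₗ (pureClosure (R := R) {a}).subtype) := by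
  rw [← LinearMap.ker_eq_bot, LinearMap.ker_eq_bot']
  rintro ⟨b, hb⟩ h0
  obtain ⟨s, hs, c, hc⟩ := mem_pureClosure_singleton.1 hb
  replace h0 : f b = 0 := h0
  have h1 : c • f a = 0 := by rw [← map_smul, hc, map_smul, h0, smul_zero]
  have hc0 : c = 0 := (smul_eq_zero.1 h1).resolve_right ha
  rw [hc0, zero_smul] at hc
  exact Subtype.ext ((smul_eq_zero.1 hc.symm).resolve_left hs)

variable [Module.IsTorsionFree R A]

theorem typeOfElement_le_of_apply_ne_zero {a x : A} (ha : a ≠ 0) (hx : x ≠ 0)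
    (f : A →ₗ[R] pureClosure (R := R) {x}) (h : f a ≠ 0) :
    typeOfElement R a ha ≤ typeOfElement R x hx :=
  (typeOf_le_typeOf_iff _ _).2 ⟨_, injective_comp_subtype_pureClosure f h⟩

omit [IsDomain R] [Module.IsTorsionFree R A] in
-- The two kernels are proper subgroups, and their union cannot be all of `A`.
theorem exists_apply_ne_zero_and_apply_ne_zero {M N : Type*} [AddCommGroup M] [Module R M]
    [AddCommGroup N] [Module R N] {f : A →ₗ[R] M} {g : A →ₗ[R] N} (hf : f ≠ 0) (hg : g ≠ 0) :
    ∃ a, f a ≠ 0 ∧ g a ≠ 0 := by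
  obtain ⟨y, hy⟩ := DFunLike.ne_iff.1 hf
  obtain ⟨z, hz⟩ := DFunLike.ne_iff.1 hg
  simp only [LinearMap.zero_apply] at hy hz
  by_cases h1 : g y = 0
  · by_cases h2 : f z = 0
    · exact ⟨y + z, by simpa [h2] using hy, by simpa [h1] using hz⟩
    · exact ⟨z, h2, hz⟩
  · exact ⟨y, hy, h1⟩

/-- If `A` maps nontrivially to all its pure submodules of rank one, then the inner type of `A`
is the type of an element. -/
theorem MaximalIndependentSystem.exists_typeOfElement_eq_infType
    (H : ∀ x : A, x ≠ 0 → ∃ f : A →ₗ[R] pureClosure (R := R) {x}, f ≠ 0)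
    (S : MaximalIndependentSystem R A) :
    ∃ (x : A) (hx : x ≠ 0), typeOfElement R x hx = S.infType := by
  have D : Directed (· ≥ ·) fun a : {a : A // a ≠ 0} => typeOfElement R a.1 a.2 := by
    rintro ⟨x, hx⟩ ⟨y, hy⟩
    obtain ⟨f, hf⟩ := H x hx
    obtain ⟨g, hg⟩ := H y hy
    obtain ⟨a, h1, h2⟩ := exists_apply_ne_zero_and_apply_ne_zero hf hg
    have ha : a ≠ 0 := by rintro rfl; exact h1 (map_zero f)
    exact ⟨⟨a, ha⟩, typeOfElement_le_of_apply_ne_zero ha hx f h1,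
      typeOfElement_le_of_apply_ne_zero ha hy g h2⟩
  have : Nonempty {a : A // a ≠ 0} := ⟨⟨S.x 0, S.linearIndependent.ne_zero 0⟩⟩
  -- Directedness gives a single element whose type lies below those of the finitely many members of
  -- `S`.
  obtain ⟨⟨x, hx⟩, h⟩ := D.finite_le fun i => ⟨S.x i, S.linearIndependent.ne_zero i⟩
  exact ⟨x, hx, le_antisymm (Finset.le_inf' _ _ fun i _ => h i) (S.isGLB_infType.1 ⟨x, hx, rfl⟩)⟩

omit [IsDomain R] [Module.IsTorsionFree R A] in
theorem exists_ne_zero_of_isGeneratedBy {M : Type w} [AddCommGroup M] [Module R M] [Nontrivial M]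
    (h : IsGeneratedBy R A M) : ∃ f : A →ₗ[R] M, f ≠ 0 := by
  obtain ⟨I, F, hF⟩ := h
  by_contra! hcon
  have h0 : F = 0 := Finsupp.lhom_ext' fun i => by
    rw [hcon (F ∘ₗ Finsupp.lsingle i), LinearMap.zero_comp]
  obtain ⟨m, hm⟩ := exists_ne (0 : M)
  obtain ⟨t, ht⟩ := hF m
  exact hm (by rw [← ht, h0, LinearMap.zero_apply])

omit [IsDomain R] [Module.IsTorsionFree R A] in
-- One copy of `A` is taken for each homomorphism A → M, so the range of the evaluation map is the
-- trace of `A` in `M`.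
theorem isGeneratedBy_of_mem_span {M : Type v} [AddCommGroup M] [Module R M]
    (h : ∀ m : M, m ∈ Submodule.span R {m | ∃ (f : A →ₗ[R] M) (a : A), f a = m}) :
    IsGeneratedBy R A M := by
  refine ⟨A →ₗ[R] M, Finsupp.lsum R fun f => f, ?_⟩
  rw [← LinearMap.range_eq_top, eq_top_iff]
  intro m _
  refine Submodule.span_le.2 ?_ (h m)
  rintro _ ⟨f, a, rfl⟩
  exact ⟨Finsupp.single f a, by simp⟩

/-- A pure submodule of rank one generated by `y` splits off up to quasi-equality if `A` maps
to a rank one module of type at most that of `y` with `y` outside the kernel. -/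
theorem isQuasiDirectSummand_pureClosure {x y : A}
    (f : A →ₗ[R] pureClosure (R := R) {x}) (hy : f y ≠ 0)
    (h : ∃ g : pureClosure (R := R) {x} →ₗ[R] pureClosure (R := R) {y}, Function.Injective g) :
    IsQuasiDirectSummand (pureClosure (R := R) {y}) := by
  have hi := injective_comp_subtype_pureClosure f hy
  have hx : x ≠ 0 := by
    rintro rfl
    obtain ⟨s, hs, c, hc⟩ := mem_pureClosure_singleton.1 (f y).2
    rw [smul_zero] at hc
    exact hy (Subtype.ext ((smul_eq_zero.1 hc.symm).resolve_left hs))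
  obtain ⟨g, hg⟩ := h
  let x₀ : pureClosure (R := R) {x} := ⟨x, mem_pureClosure_self x⟩
  let k : pureClosure (R := R) {x} →ₗ[R] pureClosure (R := R) {x} :=
    (f ∘ₗ (pureClosure (R := R) {y}).subtype) ∘ₗ g
  have hk : Function.Injective k := hi.comp hg
  obtain ⟨s, hs, c, hc⟩ := mem_pureClosure_singleton.1 (k x₀).2
  -- An endomorphism of a rank one module is multiplication by a fraction, here c/s as read off at
  -- x.
  have hkey : ∀ z, s • k z = c • z := by
    intro z
    obtain ⟨t, ht, d, hd⟩ := mem_pureClosure_singleton.1 z.2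
    have hd' : d • x₀ = t • z := Subtype.ext hd
    apply smul_right_injective _ ht
    change t • s • k z = t • c • z
    rw [smul_comm t s, ← map_smul, ← hd', map_smul, smul_comm t c, ← hd', smul_comm s, smul_comm c]
    congr 1
    exact Subtype.ext hc.symm
  have hc0 : c ≠ 0 := by
    rintro rfl
    have h1 := hkey x₀
    rw [zero_smul] at h1
    have h2 := (smul_eq_zero.1 h1).resolve_left hs
    exact hx (congrArg Subtype.val (hk (h2.trans (map_zero k).symm)))
  refine ⟨LinearMap.ker f, ?_, c, hc0, fun a => ?_⟩
  · rw [Submodule.disjoint_def]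
    intro b hb hb0
    exact congrArg Subtype.val (hi (a₁ := ⟨b, hb⟩) (a₂ := 0) (by simpa using hb0))
  · have h1 : f (s • (g (f a) : A)) = f (c • a) := by
      rw [map_smul, map_smul]
      exact hkey (f a)
    refine Submodule.mem_sup.2 ⟨s • (g (f a) : A), Submodule.smul_mem _ _ (g (f a)).2,
      c • a - s • (g (f a) : A), ?_, by simp⟩
    rw [LinearMap.mem_ker, map_sub, h1, sub_self]

omit [IsDomain R] [Module.IsTorsionFree R A] in
-- Multiplication by r carries `A` into B ⊕ C; the map is its composite with the projection to `B`.
theorem IsQuasiDirectSummand.exists_linearMap {B : Submodule R A} (h : IsQuasiDirectSummand B) :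
    ∃ r : R, r ≠ 0 ∧ ∃ f : A →ₗ[R] B, ∀ b : B, f b = r • b := by
  obtain ⟨C, hBC, r, hr, H⟩ := h
  let φ : (B × C) →ₗ[R] A := LinearMap.coprod B.subtype C.subtype
  have hφ : Function.Injective φ := by
    rw [← LinearMap.ker_eq_bot, LinearMap.ker_coprod_of_disjoint_range]
    · simp
    · simpa using hBC
  have hrange : ∀ a : A, r • a ∈ LinearMap.range φ := by
    intro a
    rw [LinearMap.range_coprod, Submodule.range_subtype, Submodule.range_subtype]
    exact H a
  let e := LinearEquiv.ofInjective φ hφ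
  refine ⟨r, hr, LinearMap.fst R B C ∘ₗ e.symm.toLinearMap ∘ₗ
    (LinearMap.lsmul R A r).codRestrict (LinearMap.range φ) hrange, fun b => ?_⟩
  have h1 : (LinearMap.lsmul R A r).codRestrict (LinearMap.range φ) hrange b = e (r • b, 0) := by
    apply Subtype.ext
    simp only [e, φ, LinearEquiv.ofInjective_apply, LinearMap.coprod_apply, map_zero, add_zero]
    rfl
  simp only [LinearMap.comp_apply, h1, LinearEquiv.coe_coe, LinearEquiv.symm_apply_apply,
    LinearMap.fst_apply]

end TypeComparison

/-! ### Splitting maps onto rank one modules -/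

section Splitting

variable {R : Type u} [CommRing R] [IsDedekindDomain R] {A : Type v} [AddCommGroup A] [Module R A]

local notation "K" => FractionRing R

/-- The ideal of all `s` such that multiplication by `s` on the range of `f` lifts through `f`. -/
def liftIdeal {M : Type w} [AddCommGroup M] [Module R M] (f : A →ₗ[R] M) : Ideal R where
  carrier := {s | ∃ g : LinearMap.range f →ₗ[R] A, ∀ y, f (g y) = s • (y : M)}
  zero_mem' := ⟨0, by simp⟩
  add_mem' := by
    rintro s t ⟨g, hg⟩ ⟨h, hh⟩
    exact ⟨g + h, fun y => by simp [hg, hh, add_smul]⟩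
  smul_mem' := by
    rintro c s ⟨g, hg⟩
    exact ⟨c • g, fun y => by simp [hg, mul_smul]⟩

/-- Baer's lemma over a Dedekind domain: `f` splits if its range is a module of rank one that
embeds in the pure submodule generated by any element outside the kernel. -/
theorem exists_rightInverse_of_injective [Module.IsTorsionFree R A] (f : A →ₗ[R] K) (hf : f ≠ 0)
    (H : ∀ a, f a ≠ 0 →
      ∃ g : LinearMap.range f →ₗ[R] pureClosure (R := R) {a}, Function.Injective g) :
    ∃ g : LinearMap.range f →ₗ[R] A, ∀ y, f (g y) = y := by
  set Y := LinearMap.range f with hY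
  -- For f a ≠ 0, f is injective on the pure closure W of a. Any s with sY ⊆ f(W) lies in the
  -- lifting ideal, and f(W) contains a nonzero multiple of Y, so `mem_mul_of_bounded` applies to Z
  -- = f(W).
  have hle : Y ≤ IsLocalization.coeSubmodule K (liftIdeal f) * Y := by
    rintro _ ⟨a, rfl⟩
    by_cases ha : f a = 0
    · rw [ha]; exact zero_mem _
    let W := pureClosure (R := R) {a}
    let fW : W →ₗ[R] K := f ∘ₗ W.subtype
    have hfW : Function.Injective fW := injective_comp_subtype_pureClosure f ha
    obtain ⟨g, hg⟩ := H a ha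
    obtain ⟨q, hq⟩ := exists_eq_mul (fW ∘ₗ g)
    have hq0 : q ≠ 0 := by
      rintro rfl
      have h1 : g ⟨f a, a, rfl⟩ = g 0 := hfW (by
        have := hq ⟨f a, a, rfl⟩
        simpa using this)
      exact ha (congrArg Subtype.val (hg h1))
    -- As fg is multiplication by q on Y, the relation d = cq gives dy = f(c · g y).
    obtain ⟨d, c, hd, e⟩ := exists_smul_eq_smul (R := R) 1 q hq0
    refine mem_mul_of_bounded (Z := LinearMap.range fW) ?_ hd (fun y hy => ?_) (fun s hs => ?_)
      ⟨⟨a, mem_pureClosure_self a⟩, rfl⟩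
    · rintro _ ⟨w, rfl⟩
      exact ⟨w, rfl⟩
    · refine ⟨c • g ⟨y, hy⟩, ?_⟩
      have := hq ⟨y, hy⟩
      simp only [LinearMap.comp_apply] at this
      rw [map_smul, LinearMap.comp_apply, Submodule.subtype_apply]
      simp only [Algebra.smul_def, mul_one] at e ⊢
      rw [e, mul_assoc, ← this]
      rfl
    · refine ⟨W.subtype ∘ₗ (LinearEquiv.ofInjective fW hfW).symm.toLinearMap ∘ₗ
        ((LinearMap.lsmul R K s ∘ₗ Y.subtype).codRestrict _ fun y => hs y y.2), fun y => ?_⟩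
      have := (LinearEquiv.ofInjective fW hfW).apply_symm_apply
        ((LinearMap.lsmul R K s ∘ₗ Y.subtype).codRestrict (LinearMap.range fW)
          (fun y => hs y y.2) y)
      exact congrArg Subtype.val this
  have heq : IsLocalization.coeSubmodule K (liftIdeal f) * Y = Y := by
    refine le_antisymm (Submodule.mul_le.2 ?_) hle
    rintro _ ⟨r, _, rfl⟩ y hy
    rw [Algebra.linearMap_apply, ← Algebra.smul_def]
    exact Y.smul_mem r hy
  have hJ : liftIdeal f ≠ ⊥ := by
    intro h0
    rw [h0, IsLocalization.coeSubmodule_bot, Submodule.bot_mul] at heq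
    exact hf (LinearMap.range_eq_bot.1 heq.symm)
  have hinv := coe_inv_mul_coeSubmodule hJ
  set P : Submodule R K := (((liftIdeal f : FractionalIdeal R⁰ K)⁻¹ : FractionalIdeal R⁰ K) :
    Submodule R K) with hP
  -- Multiplying JY = Y by J⁻¹ shows that J⁻¹ preserves Y.
  have hPY : P * Y = Y := by
    conv_lhs => arg 2; rw [← heq]
    rw [← mul_assoc, hinv, one_mul]
  -- For a product pj, multiply by p inside Y and then apply a lift of j; the case c = 1 is the
  -- splitting.
  have key : ∀ c ∈ P * IsLocalization.coeSubmodule K (liftIdeal f),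
      ∃ g : Y →ₗ[R] A, ∀ y, f (g y) = c * y := by
    intro c hc
    induction hc using Submodule.mul_induction_on' with
    | mem_mul_mem p hp _ hj =>
      obtain ⟨j, ⟨g, hg⟩, rfl⟩ := hj
      refine ⟨g ∘ₗ (LinearMap.mulLeft R p).restrict (p := Y) (q := Y) fun y hy => ?_,
        fun y => ?_⟩
      · rw [← hPY]; exact Submodule.mul_mem_mul hp hy
      · rw [LinearMap.comp_apply, hg]
        simp only [LinearMap.coe_restrict_apply, LinearMap.mulLeft_apply, Algebra.smul_def,
          Algebra.linearMap_apply]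
        ring
    | add a _ b _ ha hb =>
      obtain ⟨g, hg⟩ := ha
      obtain ⟨h, hh⟩ := hb
      exact ⟨g + h, fun y => by rw [LinearMap.add_apply, map_add, hg, hh, add_mul]⟩
  obtain ⟨g, hg⟩ := key 1 (by rw [hinv]; exact Submodule.one_le.1 le_rfl)
  exact ⟨g, fun y => by rw [hg, one_mul]⟩

omit [IsDedekindDomain R] in
theorem isCompl_range_ker_of_rightInverse {M : Type w} [AddCommGroup M] [Module R M]
    (f : A →ₗ[R] M) (g : LinearMap.range f →ₗ[R] A) (h : ∀ y, f (g y) = y) :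
    IsCompl (LinearMap.range g) (LinearMap.ker f) := by
  constructor
  · rw [Submodule.disjoint_def]
    rintro _ ⟨y, rfl⟩ hy
    have : y = 0 := Subtype.ext (by rw [← h y]; exact hy)
    rw [this, map_zero]
  · rw [codisjoint_iff, eq_top_iff]
    intro a _
    refine Submodule.mem_sup.2 ⟨g ⟨f a, a, rfl⟩, ⟨_, rfl⟩, a - g ⟨f a, a, rfl⟩, ?_, by simp⟩
    rw [LinearMap.mem_ker, map_sub, h, sub_self]

end Splitting

/-! ### Summands realizing the inner type -/

section InnerTypeSummand

variable {R : Type u} [CommRing R] [IsDedekindDomain R] {A : Type v} [AddCommGroup A] [Module R A]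
  [Module.IsTorsionFree R A]

/-- A quasi-direct summand whose type is a lower bound for the types of elements is
quasi-isomorphic to a direct summand. -/
theorem IsQuasiDirectSummand.exists_isDirectSummand {B : Submodule R A}
    (hB : Module.rank R B = 1) (h : IsQuasiDirectSummand B)
    (H : ∀ (a : A) (ha : a ≠ 0), typeOf R B hB ≤ typeOfElement R a ha) :
    ∃ (B' : Submodule R A) (hB' : Module.rank R B' = 1),
      IsDirectSummand B' ∧ typeOf R B' hB' = typeOf R B hB := by
  obtain ⟨r, hr, f₀, hf₀⟩ := h.exists_linearMap
  obtain ⟨X, ⟨e⟩⟩ := exists_rankOneSub R B hB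
  let f : A →ₗ[R] FractionRing R := X.1.subtype ∘ₗ e.toLinearMap ∘ₗ f₀
  have hfe : ∀ b : B, f b = r • (e b : FractionRing R) := fun b => by
    simp only [f, LinearMap.comp_apply, hf₀, LinearEquiv.coe_coe, map_smul,
      Submodule.subtype_apply]
  obtain ⟨x, hx, hx0⟩ := Submodule.exists_mem_ne_zero_of_ne_bot X.2
  have hf : f ≠ 0 := by
    intro h0
    have h1 := hfe (e.symm ⟨x, hx⟩)
    rw [h0, LinearMap.zero_apply, e.apply_symm_apply] at h1
    exact smul_ne_zero hr hx0 h1.symm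
  let Y : RankOneSub R := ⟨LinearMap.range f, fun h0 => hf (LinearMap.range_eq_bot.1 h0)⟩
  have hYX : Y.1 ≤ X.1 := by
    rintro _ ⟨a, rfl⟩
    exact (e (f₀ a)).2
  -- The range lies between rX and X because f restricts to r times the isomorphism B ≅ X.
  have hYB : typeOf R B hB = RankOneType.mk Y := by
    rw [typeOf_eq_mk hB X e]
    refine Quotient.sound (quasiIso_of_injective (injective_of_mul (q := algebraMap R _ r) ?_ ?_)
      ⟨Submodule.inclusion hYX, Submodule.inclusion_injective _⟩)
    · exact fun h0 => hr (IsFractionRing.injective R (FractionRing R) (by rw [h0, map_zero]))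
    · intro x hx
      refine ⟨e.symm ⟨x, hx⟩, ?_⟩
      rw [hfe, e.apply_symm_apply, Algebra.smul_def]
  obtain ⟨g, hg⟩ := exists_rightInverse_of_injective f hf fun a ha => by
    have ha0 : a ≠ 0 := by rintro rfl; exact ha (map_zero f)
    have h1 := H a ha0
    rw [hYB] at h1
    exact (mk_le_typeOf_iff (rank_pureClosure_singleton ha0) Y).1 h1
  have hgi : Function.Injective g := fun y z hyz => Subtype.ext (by rw [← hg, hyz, hg])
  let e' := LinearEquiv.ofInjective g hgi
  obtain ⟨⟨i, hi⟩, j, hj⟩ := (typeOf_eq_mk_iff hB Y).1 hYB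
  have hB' : Module.rank R (LinearMap.range g) = 1 := by
    rw [← hB]
    apply le_antisymm
    · exact LinearMap.rank_le_of_injective (i ∘ₗ e'.symm.toLinearMap) (hi.comp e'.symm.injective)
    · exact LinearMap.rank_le_of_injective (e'.toLinearMap ∘ₗ j) (e'.injective.comp hj)
  exact ⟨LinearMap.range g, hB', ⟨_, isCompl_range_ker_of_rightInverse f g hg⟩,
    (typeOf_eq_mk hB' Y e'.symm).trans hYB.symm⟩

omit [Module.IsTorsionFree R A] in
/-- A rank one module generates all rank one modules of larger type. -/
theorem mem_span_range_of_le {X Y : RankOneSub R}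
    (h : ∃ f : X.1 →ₗ[R] Y.1, Function.Injective f) (y : Y.1) :
    y ∈ Submodule.span R {y | ∃ (f : X.1 →ₗ[R] Y.1) (x : X.1), f x = y} := by
  obtain ⟨q, hq, hm⟩ := exists_mul_of_injective h
  let B : Submodule R (FractionRing R) := X.1.map (LinearMap.mulLeft R q)
  have hB : B ≠ ⊥ := by
    obtain ⟨x, hx, hx0⟩ := Submodule.exists_mem_ne_zero_of_ne_bot X.2
    exact (Submodule.ne_bot_iff _).2 ⟨q * x, ⟨x, hx, rfl⟩, mul_ne_zero hq hx0⟩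
  have hBY : B ⊔ Submodule.span R {(y : FractionRing R)} ≤ Y.1 := by
    refine sup_le ?_ ((Submodule.span_singleton_le_iff_mem _ _).2 y.2)
    rintro _ ⟨x, hx, rfl⟩
    exact hm x hx
  have hy : (y : FractionRing R) ∈ B ⊔ Submodule.span R {(y : FractionRing R)} :=
    Submodule.mem_sup_right (Submodule.mem_span_singleton_self _)
  rw [← inv_denominatorIdeal_mul hB] at hy hBY
  -- Each product pb with b = qx is the image of x under multiplication by pq, which maps all of X
  -- into I⁻¹B ⊆ Y.
  suffices H : ∀ z (hz : z ∈ Y.1), z ∈ _ →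
      (⟨z, hz⟩ : Y.1) ∈ Submodule.span R {y | ∃ (f : X.1 →ₗ[R] Y.1) (x : X.1), f x = y} from
    H y y.2 hy
  intro z hz hzm
  induction hzm using Submodule.mul_induction_on' with
  | mem_mul_mem p hp b hb =>
    obtain ⟨x, hx, rfl⟩ := hb
    refine Submodule.subset_span ⟨(LinearMap.mulLeft R (p * q)).restrict fun x' hx' => ?_,
      ⟨x, hx⟩, Subtype.ext (mul_assoc p q x)⟩
    rw [LinearMap.mulLeft_apply, mul_assoc]
    exact hBY (Submodule.mul_mem_mul hp ⟨x', hx', rfl⟩)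
  | add a ha b hb iha ihb => exact add_mem (iha (hBY ha)) (ihb (hBY hb))

theorem IsDirectSummand.isSelfPureGenerator {B : Submodule R A}
    (hB : Module.rank R B = 1) (h : IsDirectSummand B)
    (H : ∀ (a : A) (ha : a ≠ 0), typeOf R B hB ≤ typeOfElement R a ha) :
    IsSelfPureGenerator R A := by
  intro L hL
  obtain ⟨C, hC⟩ := h
  refine isGeneratedBy_of_mem_span fun a => ?_
  by_cases ha : (a : A) = 0
  · have : a = 0 := Subtype.ext ha
    rw [this]; exact zero_mem _
  have hW := rank_pureClosure_singleton (R := R) ha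
  have hWL : pureClosure (R := R) {(a : A)} ≤ L :=
    (isLeast_pureClosure _).2 ⟨hL, by simp⟩
  obtain ⟨X, ⟨e⟩⟩ := exists_rankOneSub R B hB
  obtain ⟨Y, ⟨e'⟩⟩ := exists_rankOneSub R _ hW
  obtain ⟨f, hf⟩ := (typeOf_le_typeOf_iff hB hW).1 (H a ha)
  let a₀ : pureClosure (R := R) {(a : A)} := ⟨a, mem_pureClosure_self _⟩
  let i : Y.1 →ₗ[R] L := Submodule.inclusion hWL ∘ₗ e'.symm.toLinearMap
  have hi : i (e' a₀) = a := by
    apply Subtype.ext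
    simp [i, a₀]
  have hmem := Submodule.mem_map_of_mem (f := i) (mem_span_range_of_le
    ⟨e'.toLinearMap ∘ₗ f ∘ₗ e.symm.toLinearMap,
      e'.injective.comp (hf.comp e.symm.injective)⟩ (e' a₀))
  rw [hi, Submodule.map_span] at hmem
  refine Submodule.span_mono ?_ hmem
  rintro _ ⟨_, ⟨k, x, rfl⟩, rfl⟩
  -- A map out of X ≅ B extends to `A` along the projection, which fixes the element of `B`
  -- corresponding to x.
  refine ⟨i ∘ₗ k ∘ₗ e.toLinearMap ∘ₗ Submodule.projectionOnto B C hC, e.symm x, ?_⟩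
  simp

variable [Nontrivial A]

theorem isGLB_innerType (hA : Module.rank R A < Cardinal.aleph0) :
    IsGLB {t : RankOneType R | ∃ (a : A) (ha : a ≠ 0), t = typeOfElement R a ha}
      (innerType R A hA) :=
  MaximalIndependentSystem.isGLB_infType _

theorem exists_isQuasiDirectSummand_of_isGeneratedBy (hA : Module.rank R A < Cardinal.aleph0)
    (h : ∀ L : Submodule R A, IsPure L → Module.rank R L = 1 → IsGeneratedBy R A L) :
    ∃ (B : Submodule R A) (hB : Module.rank R B = 1),
      IsQuasiDirectSummand B ∧ typeOf R B hB = innerType R A hA := by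
  have H : ∀ x : A, x ≠ 0 → ∃ f : A →ₗ[R] pureClosure (R := R) {x}, f ≠ 0 := by
    intro x hx
    have : Nontrivial (pureClosure (R := R) {x}) :=
      ⟨⟨x, mem_pureClosure_self x⟩, 0, fun h => hx (congrArg Subtype.val h)⟩
    exact exists_ne_zero_of_isGeneratedBy
      (h _ (isLeast_pureClosure {x}).1.1 (rank_pureClosure_singleton hx))
  let S := Classical.choice (nonempty_maximalIndependentSystem R A hA)
  obtain ⟨x, hx, hxS⟩ := S.exists_typeOfElement_eq_infType H
  obtain ⟨f, hf⟩ := H x hx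
  obtain ⟨y, hy⟩ := DFunLike.ne_iff.1 hf
  have hy0 : y ≠ 0 := by rintro rfl; exact hy (map_zero f)
  have hyx : typeOfElement R x hx ≤ typeOfElement R y hy0 := by
    rw [hxS]; exact S.isGLB_infType.1 ⟨y, hy0, rfl⟩
  refine ⟨pureClosure (R := R) {y}, rank_pureClosure_singleton hy0,
    isQuasiDirectSummand_pureClosure f hy ((typeOf_le_typeOf_iff _ _).1 hyx), ?_⟩
  -- Minimality of the type of x gives one inequality, and f y ≠ 0 the other.
  exact (le_antisymm hyx (typeOfElement_le_of_apply_ne_zero hy0 hx f hy)).symm.trans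
    (hxS.trans (innerType_eq R A hA S).symm)

end InnerTypeSummand

end DedekindTF

theorem theorem2p4 {R : Type*} [CommRing R] [IsDedekindDomain R]
    {A : Type*} [AddCommGroup A] [Module R A] [Module.IsTorsionFree R A] [Nontrivial A]
    (hA : Module.rank R A < Cardinal.aleph0) :
    [ DedekindTF.IsSelfPureGenerator R A,
      ∀ K : Submodule R A, DedekindTF.IsPure K → Module.rank R K = 1 →
        DedekindTF.IsGeneratedBy R A K,
      ∃ (B : Submodule R A) (hB : Module.rank R B = 1),
        DedekindTF.IsQuasiDirectSummand B ∧
          DedekindTF.typeOf R B hB = DedekindTF.innerType R A hA,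
      ∃ (B : Submodule R A) (hB : Module.rank R B = 1),
        DedekindTF.IsDirectSummand B ∧
          DedekindTF.typeOf R B hB = DedekindTF.innerType R A hA ].TFAE := by
  -- Both 3 → 4 and 4 → 1 use of the inner type only that it bounds the types of all nonzero
  -- elements from below.
  have hle : ∀ (B : Submodule R A) (hB : Module.rank R B = 1),
      DedekindTF.typeOf R B hB = DedekindTF.innerType R A hA → ∀ (a : A) (ha : a ≠ 0),
        DedekindTF.typeOf R B hB ≤ DedekindTF.typeOfElement R a ha := by
    intro B hB h a ha
    rw [h]
    exact (DedekindTF.isGLB_innerType hA).1 ⟨a, ha, rfl⟩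
  tfae_have 1 → 2 := fun h K hK _ => h K hK
  tfae_have 2 → 3 := DedekindTF.exists_isQuasiDirectSummand_of_isGeneratedBy hA
  tfae_have 3 → 4 := by
    rintro ⟨B, hB, hs, ht⟩
    obtain ⟨B', hB', hs', ht'⟩ := hs.exists_isDirectSummand hB (hle B hB ht)
    exact ⟨B', hB', hs', ht'.trans ht⟩
  tfae_have 4 → 1 := by
    rintro ⟨B, hB, hs, ht⟩
    exact hs.isSelfPureGenerator hB (hle B hB ht)
  tfae_finish
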